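/- Let $\beta(\omega)$ be the Stone–Čech compactification of the countably infinite discrete space $\omega$, and let $\omega^{*}=\beta(\omega)\setminus\omega$. For topological spaces $X$ and $Y$, a cardinal $\kappa$ and an index set of size $\lambda$, write $X\rightarrow(Y)^{\kappa}_{\lambda}$ if, whenever the set $[X]^{\kappa}$ of all subsets of $X$ with exactly $\kappa$ members is written in the form $[X]^{\kappa}=\bigcup_{i<\lambda}P_i$, there are $i<\lambda$ and a subspace $Y'\subseteq X$ homeomorphic to $Y$ such that $[Y']^{\kappa}\subseteq P_i$. Theorem. For every $p\in\omega^{*}$, the relation $\omega^{*}\rightarrow(\omega\cup\{p\})^{1}_{2}$ fails, where $\omega\cup\{p\}$ carries the subspace topology from $\beta(\omega)$. Equivalently, for every $p\in\omega^{*}$ there are $P_0,P_1$ with $\omega^{*}=P_0\cup P_1$ such that neither $P_0$ nor $P_1$ contains a subspace homeomorphic to $\omega\cup\{p\}$. -/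

import Mathlib

universe u v w

/-- The topological partition relation `X → (Y)^κ_ι`: whenever the collection `[X]^κ` of all
subsets of `X` with exactly `κ` members is written as a union `⋃ i, P i` indexed by `ι`, there are
an index `i` and a subspace `Y'` of `X` homeomorphic to `Y` all of whose `κ`-membered subsets lie
in `P i`. Only the cardinality of the index type matters; for `λ = 2` colours take `ι = Fin 2`. -/
def TopArrow (X : Type u) [TopologicalSpace X] (Y : Type v) [TopologicalSpace Y]
    (κ : Cardinal.{u}) (ι : Type w) : Prop :=
  ∀ P : ι → Set (Set X), {A : Set X | Cardinal.mk A = κ} = ⋃ i, P i →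
    ∃ i : ι, ∃ Y' : Set X, Nonempty (Y ≃ₜ Y') ∧
      ∀ A : Set X, A ⊆ Y' → Cardinal.mk A = κ → A ∈ P i

/-- The copy of the discrete space `ω` inside its Stone–Čech compactification `β(ω)`. The latter is
realised in the standard way as the space `Ultrafilter ℕ` of all ultrafilters on `ω`, with Mathlib's
topology, generated by the sets of ultrafilters containing a given `A ⊆ ω`; the points of `ω` are
the principal ultrafilters. -/
def omegaInBeta : Set (Ultrafilter ℕ) := Set.range (pure : ℕ → Ultrafilter ℕ)

/-- The Stone–Čech remainder `ω* = β(ω) \ ω`. -/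
def omegaStar : Set (Ultrafilter ℕ) := omegaInBetaᶜ

/-- The subspace `ω ∪ {p}` of `β(ω)`. -/
def omegaWithPoint (p : Ultrafilter ℕ) : Set (Ultrafilter ℕ) := omegaInBeta ∪ {p}

open Filter

/-! A copy of `ω ∪ {p}` yields a separated sequence `y` together with its limit `p.bind y`. By
`Separated.eventually_eq`, a point `z` is such a limit of at most one sequence modulo `p`; fix one,
`x z`, whenever it exists, and call its terms the children of `z`. It then suffices to two-colour
`β(ω)` so that every such `z` differs in colour from `p`-almost all its children
(`exists_alternating_colouring`): a copy with limit `z` contains `z` and almost all of its children.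

By Zorn's lemma, it is enough to extend a proper partial colouring to one more point. The
descendants of that point are countable and are treated one at a time. Each step colours a single
point or part of a sequence of children, and must not force contradictory colours elsewhere. The new
points stay `Thin`, so the children of `q` can be cut down to a neighbourhood of `q` that avoids
every other new point endangered by the step.

Both uniqueness and thinness rest on one rigidity fact, `eventually_eq_of_map_eq`. -/

/-- A family of ultrafilters is separated when its members contain pairwise disjoint sets, given
here as the fibres of a map. -/
def Separated (y : ℕ → Ultrafilter ℕ) : Prop := ∃ h : ℕ → ℕ, ∀ n, ∀ᶠ k in y n, h k = n

/-! ### Limits along ultrafilters, and self-maps fixing an ultrafilter. -/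

namespace Ultrafilter

theorem eventually_bind {p : Ultrafilter ℕ} {x : ℕ → Ultrafilter ℕ} {P : ℕ → Prop} :
    (∀ᶠ k in p.bind x, P k) ↔ ∀ᶠ n in p, ∀ᶠ k in x n, P k := Iff.rfl

theorem mem_closure_iff_eventually {S : Set (Ultrafilter ℕ)} {z : Ultrafilter ℕ} :
    z ∈ closure S ↔ ∀ P : ℕ → Prop, (∀ᶠ k in z, P k) → ∃ w ∈ S, ∀ᶠ k in w, P k := by
  rw [ultrafilterBasis_is_basis.mem_closure_iff]
  constructor
  · intro h P hP
    obtain ⟨w, hw, hwS⟩ := h {u | {k | P k} ∈ u} ⟨_, rfl⟩ hP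
    exact ⟨w, hwS, hw⟩
  · rintro h _ ⟨A, rfl⟩ hA
    obtain ⟨w, hwS, hw⟩ := h (· ∈ A) hA
    exact ⟨w, hw, hwS⟩

theorem eq_of_forall_eventually {z w : Ultrafilter ℕ}
    (h : ∀ P : ℕ → Prop, (∀ᶠ k in z, P k) → ∀ᶠ k in w, P k) : z = w :=
  (Ultrafilter.coe_le_coe.1 fun s hs => h (· ∈ s) hs).symm

theorem map_eq_self {z : Ultrafilter ℕ} {f : ℕ → ℕ} (h : ∀ᶠ k in z, f k = k) : z.map f = z := by
  symm
  refine eq_of_forall_eventually fun P hP => ?_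
  change ∀ᶠ k in z, P (f k)
  filter_upwards [hP, h] with k hk hf
  rwa [hf]

theorem bind_mem_closure {p : Ultrafilter ℕ} {c : ℕ → Ultrafilter ℕ} {S : Set (Ultrafilter ℕ)}
    (h : ∀ᶠ n in p, c n ∈ closure S) : p.bind c ∈ closure S := by
  rw [mem_closure_iff_eventually]
  intro P hP
  obtain ⟨n, hn, hc⟩ := (h.and (eventually_bind.1 hP)).exists
  exact mem_closure_iff_eventually.1 hn P hc

/-- A strictly inflationary map on `ℕ` admits a two-colouring that it reverses. -/
theorem exists_parity_of_lt (f : ℕ → ℕ) (hf : ∀ n, n < f n) :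
    ∃ c : ℕ → ℕ, ∀ n, (c (f n) + c n) % 2 = 1 := by
  have mono : ∀ n, StrictMono fun i => f^[i] n := fun n =>
    strictMono_nat_of_lt_succ fun i => by
      rw [Function.iterate_succ_apply']; exact hf _
  let s : Setoid ℕ :=
    { r := fun a b => ∃ i j, f^[i] a = f^[j] b
      iseqv := by
        refine ⟨fun a => ⟨0, 0, rfl⟩, fun ⟨i, j, h⟩ => ⟨j, i, h.symm⟩, ?_⟩
        rintro a b c ⟨i, j, h⟩ ⟨k, l, h'⟩
        refine ⟨k + i, j + l, ?_⟩
        rw [Function.iterate_add_apply, h, ← Function.iterate_add_apply, Nat.add_comm,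
          Function.iterate_add_apply, h', ← Function.iterate_add_apply] }
  have hrep : ∀ a, ∃ ij : ℕ × ℕ, f^[ij.1] a = f^[ij.2] (Quotient.mk s a).out := by
    intro a
    obtain ⟨i, j, h⟩ := Setoid.symm (Quotient.mk_out (s := s) a)
    exact ⟨⟨i, j⟩, h⟩
  choose t ht using hrep
  refine ⟨fun a => (t a).1 + (t a).2, fun a => ?_⟩
  have hq : Quotient.mk s (f a) = Quotient.mk s a := Quotient.sound ⟨0, 1, rfl⟩
  have h1 := ht a
  have h2 := ht (f a)
  rw [hq] at h2
  generalize (Quotient.mk s a).out = r at h1 h2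
  rw [← Function.iterate_succ_apply] at h2
  -- Both sides are the same point of the orbit of `r`. Strict growth makes the exponents equal,
  -- which fixes the parity of the sum of the two chosen exponents.
  have h3 : f^[(t a).2 + ((t (f a)).1 + 1)] r = f^[(t (f a)).2 + (t a).1] r := by
    rw [Nat.add_comm, Function.iterate_add_apply, ← h1, ← Function.iterate_add_apply,
      Nat.add_comm, Function.iterate_add_apply, h2, ← Function.iterate_add_apply, Nat.add_comm]
  have := (mono r).injective h3
  dsimp only
  omega

theorem exists_parity_of_gt (f : ℕ → ℕ) :
    ∃ c : ℕ → ℕ, ∀ n, f n < n → (c (f n) + c n) % 2 = 1 := by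
  let c : ℕ → ℕ := WellFounded.fix (measure id).wf
    (fun n ih => if h : f n < n then ih (f n) h + 1 else 0)
  refine ⟨c, fun n hn => ?_⟩
  have : c n = c (f n) + 1 := by
    change WellFounded.fix _ _ n = _
    rw [WellFounded.fix_eq, dif_pos hn]
  omega

/-- A self-map of `ℕ` fixing an ultrafilter is almost everywhere the identity. -/
theorem eventually_eq_of_map_eq {p : Ultrafilter ℕ} {f : ℕ → ℕ} (h : p.map f = p) :
    ∀ᶠ n in p, f n = n := by
  have key : ∀ c : ℕ → ℕ, ¬ ∀ᶠ n in p, (c (f n) + c n) % 2 = 1 := by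
    intro c hc
    have push : ∀ P : ℕ → Prop, (∀ᶠ n in p, P n) → ∀ᶠ n in p, P (f n) := by
      intro P hP
      rw [← h] at hP
      exact hP
    rcases p.eventually_or.1 (Eventually.of_forall fun n => Nat.mod_two_eq_zero_or_one (c n))
      with h0 | h0
    all_goals
      obtain ⟨n, h1, h2, h3⟩ := (hc.and (h0.and (push _ h0))).exists
      omega
  obtain ⟨c, hc⟩ := exists_parity_of_gt f
  -- The value `n + 1` only makes the map strictly inflationary; `d` is used only where `n < f n`.
  obtain ⟨d, hd⟩ := exists_parity_of_lt (fun n => if n < f n then f n else n + 1)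
    (fun n => by split_ifs <;> omega)
  rcases p.eventually_or.1 (Eventually.of_forall fun n => lt_trichotomy (f n) n) with h0 | h0
  · exact (key c (h0.mono hc)).elim
  rcases p.eventually_or.1 h0 with h0 | h0
  · exact h0
  · refine (key d (h0.mono fun n hn => ?_)).elim
    simpa [hn] using hd n

end Ultrafilter

/-! ### Separated sequences and uniqueness of the sequence with a given limit. -/

namespace Separated
open Ultrafilter

/-- A map whose value at `m` is the index `n` of the fibre of `h` containing `y m`, if any. -/
theorem exists_index (h : ℕ → ℕ) (y : ℕ → Ultrafilter ℕ) :
    ∃ g : ℕ → ℕ, ∀ n m, (∀ᶠ k in y m, h k = n) → g m = n := by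
  classical
  refine ⟨fun m => if H : ∃ n, ∀ᶠ k in y m, h k = n then H.choose else 0, fun n m hn => ?_⟩
  have H : ∃ n, ∀ᶠ k in y m, h k = n := ⟨n, hn⟩
  dsimp only
  rw [dif_pos H]
  obtain ⟨k, h1, h2⟩ := (H.choose_spec.and hn).exists
  exact h1.symm.trans h2

theorem eq_bind_of_mem_closure {y : ℕ → Ultrafilter ℕ} {h : ℕ → ℕ}
    (hy : ∀ n, ∀ᶠ k in y n, h k = n) {z : Ultrafilter ℕ} (hz : z ∈ closure (Set.range y)) :
    (z.map h).bind y = z := by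
  symm
  refine eq_of_forall_eventually fun P hP => ?_
  change ∀ᶠ k in z, ∀ᶠ j in y (h k), P j
  by_contra hn
  rw [← Ultrafilter.eventually_not] at hn
  obtain ⟨_, ⟨m, rfl⟩, hm⟩ := mem_closure_iff_eventually.1 hz _ (hP.and hn)
  obtain ⟨k, ⟨_, h2⟩, h3⟩ := (hm.and (hy m)).exists
  rw [h3] at h2
  exact h2 (hm.mono fun _ h => h.1)

theorem map_bind {p : Ultrafilter ℕ} {y : ℕ → Ultrafilter ℕ} {h : ℕ → ℕ}
    (hy : ∀ᶠ n in p, ∀ᶠ k in y n, h k = n) : (p.bind y).map h = p := by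
  symm
  refine eq_of_forall_eventually fun P hP => ?_
  change ∀ᶠ n in p, ∀ᶠ k in y n, P (h k)
  filter_upwards [hP, hy] with n hn hk
  filter_upwards [hk] with k hk
  rwa [hk]

/-- The map `g` sends `p` to itself, so it is the identity almost everywhere; being also constantly
`n` on `u n`, it leaves `u n` only the point `n`. -/
theorem eventually_eq_pure {p : Ultrafilter ℕ} {u : ℕ → Ultrafilter ℕ} {g : ℕ → ℕ}
    (hu : ∀ᶠ n in p, ∀ᶠ k in u n, g k = n) (hp : p.bind u = p) :
    ∀ᶠ n in p, u n = pure n := by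
  have h1 : p.map g = p := by
    conv_lhs => rw [← hp]
    exact map_bind hu
  have h2 := eventually_eq_of_map_eq h1
  rw [← hp] at h2
  filter_upwards [hu, Ultrafilter.eventually_bind.1 h2] with n hn hn'
  symm
  refine eq_of_forall_eventually fun P hP => ?_
  filter_upwards [hn, hn'] with k hk hk'
  have : k = n := hk'.symm.trans hk
  rw [this]
  exact hP

/-- Otherwise almost all `x n` and `y n` can be separated from the other sequence, and countably
many such separations combine into two disjoint sets, both in the common limit. -/
theorem eventually_mem_closure_or {p : Ultrafilter ℕ} {x y : ℕ → Ultrafilter ℕ}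
    (h : p.bind x = p.bind y) :
    (∀ᶠ n in p, x n ∈ closure (Set.range y)) ∨ ∀ᶠ n in p, y n ∈ closure (Set.range x) := by
  by_contra! H
  obtain ⟨hx, hy⟩ := H
  have sep : ∀ u v : ℕ → Ultrafilter ℕ, ∀ n, ∃ P : ℕ → Prop,
      (u n ∉ closure (Set.range v) → ∀ᶠ k in u n, P k) ∧ ∀ m, ∀ᶠ k in v m, ¬ P k := by
    intro u v n
    by_cases hn : u n ∈ closure (Set.range v)
    · exact ⟨fun _ => False, fun h => (h hn).elim, fun m => by simp⟩
    · rw [mem_closure_iff_eventually] at hn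
      push Not at hn
      obtain ⟨P, hP, hm⟩ := hn
      exact ⟨P, fun _ => hP, fun m => hm _ ⟨m, rfl⟩⟩
  choose P hP hP' using sep x y
  choose Q hQ hQ' using sep y x
  -- Removing only the finitely many `Q i` with `i ≤ n` keeps the set large, yet makes it disjoint
  -- from its mirror image in `h2`: compare the two indices.
  have h1 : ∀ᶠ k in p.bind x, ∃ n, P n k ∧ ∀ i ∈ Set.Iic n, ¬ Q i k := by
    rw [Ultrafilter.eventually_bind]
    filter_upwards [hx] with n hn
    filter_upwards [hP n hn, (eventually_all_finite (Set.finite_Iic n)).2 fun i _ => hQ' i n]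
      with k h1 h2 using ⟨n, h1, h2⟩
  have h2 : ∀ᶠ k in p.bind x, ∃ n, Q n k ∧ ∀ i ∈ Set.Iic n, ¬ P i k := by
    rw [h, Ultrafilter.eventually_bind]
    filter_upwards [hy] with n hn
    filter_upwards [hQ n hn, (eventually_all_finite (Set.finite_Iic n)).2 fun i _ => hP' i n]
      with k h1 h2 using ⟨n, h1, h2⟩
  obtain ⟨k, ⟨n, hn, hn'⟩, m, hm, hm'⟩ := (h1.and h2).exists
  rcases le_total n m with hnm | hnm
  · exact hm' n hnm hn
  · exact hn' m hnm hm

/-- The closure of the range of `y` is a copy of `β(ω)` through `k`. There `x` becomes a separated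
sequence with `p`-limit `p`, so it is almost everywhere principal. -/
theorem eventually_eq_of_mem_closure {p : Ultrafilter ℕ} {x y : ℕ → Ultrafilter ℕ}
    (hx : Separated x) (hy : Separated y) (h : p.bind x = p.bind y)
    (hc : ∀ᶠ n in p, x n ∈ closure (Set.range y)) : ∀ᶠ n in p, x n = y n := by
  obtain ⟨f, hf⟩ := hx
  obtain ⟨k, hk⟩ := hy
  obtain ⟨g, hg⟩ := exists_index f y
  have hb : p.bind (fun n => (x n).map k) = p := by
    change (p.bind x).map k = p
    rw [h]
    exact map_bind (Eventually.of_forall hk)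
  have hs : ∀ᶠ n in p, ∀ᶠ m in (x n).map k, g m = n := by
    filter_upwards [hc] with n hn
    have := hf n
    rw [← eq_bind_of_mem_closure hk hn, Ultrafilter.eventually_bind] at this
    exact this.mono fun m hm => hg n m hm
  filter_upwards [hc, eventually_eq_pure hs hb] with n hn hn'
  rw [← eq_bind_of_mem_closure hk hn, hn']
  rfl

/-- The separated family with a given limit along `p` is unique up to a `p`-null set. -/
theorem eventually_eq {p : Ultrafilter ℕ} {x y : ℕ → Ultrafilter ℕ}
    (hx : Separated x) (hy : Separated y) (h : p.bind x = p.bind y) :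
    ∀ᶠ n in p, x n = y n := by
  rcases eventually_mem_closure_or h with hc | hc
  · exact eventually_eq_of_mem_closure hx hy h hc
  · exact (eventually_eq_of_mem_closure hy hx h.symm hc).mono fun _ h => h.symm

/-- A point `p.bind X` is isolated from those members of a separated family that are themselves
limits along `p` of separated families inside the closure of `X`. -/
theorem mem_of_mem_closure {p : Ultrafilter ℕ} {X w : ℕ → Ultrafilter ℕ}
    (hX : Separated X) (hw : Separated w) {B : Set (Ultrafilter ℕ)} (hB : B ⊆ Set.range w)
    (hc : ∀ b ∈ B, ∃ c, Separated c ∧ p.bind c = b ∧ ∀ᶠ n in p, c n ∈ closure (Set.range X))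
    (hq : p.bind X ∈ closure B) : p.bind X ∈ B := by
  obtain ⟨h, hh⟩ := hX
  obtain ⟨v, hv⟩ := hw
  obtain ⟨κ, hκ⟩ := exists_index v X
  have hcl : ∀ b ∈ B, (b.map h).bind X = b := by
    intro b hb
    obtain ⟨c, -, rfl, hc⟩ := hc b hb
    exact eq_bind_of_mem_closure hh (bind_mem_closure hc)
  have hg : ∀ n, ∃ g : ℕ → ℕ, w n ∈ B → ((w n).map h).map g = p := by
    intro n
    by_cases hb : w n ∈ B
    · obtain ⟨c, ⟨f, hf⟩, hcb, hcX⟩ := hc _ hb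
      obtain ⟨g, hg⟩ := exists_index f X
      refine ⟨g, fun _ => ?_⟩
      rw [← hcb]
      refine map_bind (p := p) (y := fun n => (c n).map h) (h := g) ?_
      filter_upwards [hcX] with n hn
      have := hf n
      rw [← eq_bind_of_mem_closure hh hn, Ultrafilter.eventually_bind] at this
      exact this.mono fun m hm => hg n m hm
    · exact ⟨id, fun h => (hb h).elim⟩
  choose g hg using hg
  -- In the coordinate `h`, `p.bind X` becomes `p`, and each `b ∈ B` is sent to `p` by its own `g
  -- n`. As `w` is separated, `κ` recovers `n`, so one map `G` serves all of `B`.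
  let G : ℕ → ℕ := fun m => g (κ m) m
  have hG : ∀ b ∈ B, (b.map h).map G = p := by
    intro b hb
    obtain ⟨n, rfl⟩ := hB hb
    have h1 : ∀ᶠ m in (w n).map h, κ m = n := by
      have := hv n
      rw [← hcl _ hb, Ultrafilter.eventually_bind] at this
      exact this.mono fun m hm => hκ n m hm
    rw [← hg n hb]
    refine eq_of_forall_eventually fun P hP => ?_
    change ∀ᶠ m in (w n).map h, P (g n m)
    have hP' : ∀ᶠ m in (w n).map h, P (g (κ m) m) := hP
    filter_upwards [h1, hP'] with m hm hm'
    rwa [hm] at hm'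
  have hpX : (p.bind X).map h = p := map_bind (Eventually.of_forall hh)
  have hGp : p.map G = p := by
    symm
    refine eq_of_forall_eventually fun P hP => ?_
    by_contra hn
    rw [← Ultrafilter.eventually_not, ← hpX] at hn
    obtain ⟨b, hb, hb'⟩ := mem_closure_iff_eventually.1 hq (fun k => ¬ P (G (h k))) hn
    have hP' := hP
    rw [← hG b hb] at hP'
    obtain ⟨k, h1, h2⟩ := (hb'.and (show ∀ᶠ k in b, P (G (h k)) from hP')).exists
    exact h1 h2
  -- By rigidity `G` is the identity near `p`, hence on some `b ∈ B`; as `G` sends `b.map h` to `p`,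
  -- the two coincide.
  have hid := eventually_eq_of_map_eq hGp
  rw [← hpX] at hid
  obtain ⟨b, hb, hb'⟩ := mem_closure_iff_eventually.1 hq (fun k => G (h k) = h k) hid
  have h1 : (b.map h).map G = b.map h := map_eq_self hb'
  have h2 : b = p.bind X := by rw [← hcl b hb, ← h1, hG b hb]
  rwa [← h2]

end Separated

namespace Separated

theorem injective {y : ℕ → Ultrafilter ℕ} (hy : Separated y) : Function.Injective y := by
  obtain ⟨h, hh⟩ := hy
  intro a b hab
  have := hh a
  rw [hab] at this
  obtain ⟨k, h1, h2⟩ := (this.and (hh b)).exists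
  exact h1.symm.trans h2

theorem eq_of_mem_closure {y : ℕ → Ultrafilter ℕ} {h : ℕ → ℕ} (hy : ∀ n, ∀ᶠ k in y n, h k = n)
    {S : Set (Ultrafilter ℕ)} (hS : S ⊆ Set.range y) {z : Ultrafilter ℕ} (hz : z ∈ closure S)
    {n : ℕ} (hn : ∀ᶠ k in z, h k = n) : z = y n := by
  refine Ultrafilter.eq_of_forall_eventually fun P hP => ?_
  obtain ⟨w, hwS, hw⟩ := Ultrafilter.mem_closure_iff_eventually.1 hz _ (hn.and hP)
  obtain ⟨j, rfl⟩ := hS hwS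
  obtain ⟨k, ⟨h1, -⟩, h2⟩ := (hw.and (hy j)).exists
  rw [← h1, h2]
  exact hw.mono fun _ h => h.2

/-- Each point of `S` is isolated in `closure S`, so a limit in `S` would make `c` constant on a set
of `p`, against injectivity. -/
theorem notMem_of_eventually_mem_closure {p : Ultrafilter ℕ} (hp : ∀ a, ∀ᶠ n in (p : Filter ℕ), n ≠ a)
    {y c : ℕ → Ultrafilter ℕ} (hy : Separated y) (hc : Separated c) {S : Set (Ultrafilter ℕ)}
    (hS : S ⊆ Set.range y) (hcS : ∀ᶠ n in p, c n ∈ closure S) : p.bind c ∉ S := by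
  intro hz
  obtain ⟨n, hn⟩ := hS hz
  obtain ⟨h, hh⟩ := id hy
  have h1 : ∀ᶠ k in p.bind c, h k = n := hn ▸ hh n
  have h2 : ∀ᶠ m in p, c m = y n := by
    filter_upwards [Ultrafilter.eventually_bind.1 h1, hcS] with m hm hm'
    exact eq_of_mem_closure hh hS hm' hm
  obtain ⟨a, ha⟩ := h2.exists
  obtain ⟨b, hb, hab⟩ := (h2.and (hp a)).exists
  exact hab (hc.injective (hb.trans ha.symm))

end Separated

/-! ### Thin sets. -/

/-- A set of ultrafilters is thin if every limit `p.bind X` of a separated family is isolated from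
the other members of the set that are limits along `p` of families inside the closure of `X`. -/
def Thin (p : Ultrafilter ℕ) (T : Set (Ultrafilter ℕ)) : Prop :=
  ∀ X, Separated X → p.bind X ∉ closure {b ∈ T | b ≠ p.bind X ∧
    ∃ c, Separated c ∧ p.bind c = b ∧ ∀ᶠ n in p, c n ∈ closure (Set.range X)}

namespace Thin

variable {p : Ultrafilter ℕ} {S T : Set (Ultrafilter ℕ)}

theorem mono (hT : Thin p T) (h : S ⊆ T) : Thin p S := fun X hX hq =>
  hT X hX (closure_mono (Set.inter_subset_inter_left _ h) hq)

theorem union (hS : Thin p S) (hT : Thin p T) : Thin p (S ∪ T) := by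
  intro X hX hq
  refine (closure_union.subset (closure_mono (fun b hb => ?_) hq)).elim (hS X hX) (hT X hX)
  exact hb.1.imp (fun h => ⟨h, hb.2⟩) fun h => ⟨h, hb.2⟩

theorem empty : Thin p ∅ := fun X _ hq => by simp at hq

theorem singleton (z : Ultrafilter ℕ) : Thin p {z} := by
  intro X _ hq
  have h := closure_mono (Set.sep_subset _ _) hq
  rw [closure_singleton, Set.mem_singleton_iff] at h
  obtain ⟨w, hw⟩ := closure_nonempty_iff.1 ⟨_, hq⟩
  exact hw.2.1 (hw.1.trans h.symm)

theorem range {w : ℕ → Ultrafilter ℕ} (hw : Separated w) : Thin p (Set.range w) := fun _ hX hq =>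
  (hX.mem_of_mem_closure hw (Set.sep_subset _ _) (fun _ hb => hb.2.2) hq).2.1 rfl

end Thin

/-! ### Forced colours and the extension of partial colourings. -/

/-- The colours forced by a partial colouring `K`: a point of `D` whose children `x z n` have, for
`p`-almost all `n`, the same forced colour, is forced to have the other one. -/
inductive Forced (p : Ultrafilter ℕ) (x : Ultrafilter ℕ → ℕ → Ultrafilter ℕ)
    (D : Set (Ultrafilter ℕ)) (K : Bool → Set (Ultrafilter ℕ)) : Bool → Ultrafilter ℕ → Prop
  | base {e : Bool} {z : Ultrafilter ℕ} : z ∈ K e → Forced p x D K e z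
  | step {e : Bool} {z : Ultrafilter ℕ} (A : Set ℕ) : z ∈ D → A ∈ p →
      (∀ n ∈ A, Forced p x D K (!e) (x z n)) → Forced p x D K e z

/-- A partial colouring is proper if its domain is closed under children and the colour of a point
of `D` differs from that of almost all of its children. -/
structure ProperOn (p : Ultrafilter ℕ) (x : Ultrafilter ℕ → ℕ → Ultrafilter ℕ)
    (D : Set (Ultrafilter ℕ)) (K : Bool → Set (Ultrafilter ℕ)) : Prop where
  disjoint : ∀ e z, z ∈ K e → z ∉ K (!e)
  closed : ∀ e z, z ∈ K e → z ∈ D → ∀ n, ∃ e', x z n ∈ K e'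
  alternating : ∀ e z, z ∈ K e → z ∈ D → ∀ᶠ n in p, x z n ∈ K (!e)

/-- A stage in extending the proper partial colouring `K₀`. -/
structure Stage (p : Ultrafilter ℕ) (x : Ultrafilter ℕ → ℕ → Ultrafilter ℕ)
    (D : Set (Ultrafilter ℕ)) (K₀ K : Bool → Set (Ultrafilter ℕ)) : Prop where
  le : K₀ ≤ K
  consistent : ∀ e z, Forced p x D K e z → ¬ Forced p x D K (!e) z
  thin : Thin p {z | ∃ e, z ∈ K e ∧ ∀ e', z ∉ K₀ e'}

section Colouring

variable {p : Ultrafilter ℕ} {x : Ultrafilter ℕ → ℕ → Ultrafilter ℕ}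
  {D : Set (Ultrafilter ℕ)} {K K' K₀ : Bool → Set (Ultrafilter ℕ)}

theorem bool_cases (e e' : Bool) : e' = e ∨ e' = !e := by cases e <;> cases e' <;> simp

namespace Forced

theorem of_eventually {e : Bool} {z : Ultrafilter ℕ} (hz : z ∈ D)
    (h : ∀ᶠ n in p, Forced p x D K (!e) (x z n)) : Forced p x D K e z :=
  step _ hz h fun _ hn => hn

theorem mono (h : K ≤ K') {e : Bool} {z : Ultrafilter ℕ} (hz : Forced p x D K e z) :
    Forced p x D K' e z := by
  induction hz with
  | base hz => exact base (h _ hz)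
  | step A hz hA _ ih => exact step A hz hA ih

theorem consistent_of_base (h : ∀ e z, z ∈ K e → ¬ Forced p x D K (!e) z) {e : Bool}
    {z : Ultrafilter ℕ} (hz : Forced p x D K e z) : ¬ Forced p x D K (!e) z := by
  induction hz with
  | base hz => exact h _ _ hz
  | @step e z A hz hA hc ih =>
    intro h'
    cases h' with
    | base h' => exact h _ _ h' (by rw [Bool.not_not]; exact step A hz hA hc)
    | step B _ hB hd =>
      obtain ⟨n, hn, hn'⟩ := p.nonempty_of_mem (inter_mem hA hB)
      exact ih n hn (hd n hn')

/-- Almost all children of an originally coloured point of `D` already carry the opposite original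
colour, so by induction forcing cannot disagree with it. -/
theorem mem_of_properOn (h₀ : ProperOn p x D K₀)
    (hK : ∀ e z, z ∈ K e → (∃ e', z ∈ K₀ e') → z ∈ K₀ e) {e : Bool} {z : Ultrafilter ℕ}
    (hz : Forced p x D K e z) (hz₀ : ∃ e', z ∈ K₀ e') : z ∈ K₀ e := by
  induction hz with
  | base hz => exact hK _ _ hz hz₀
  | @step e z A hz hA _ ih =>
    obtain ⟨e', he'⟩ := hz₀
    rcases bool_cases e e' with rfl | rfl
    · exact he'
    · obtain ⟨n, hn, hn'⟩ := p.nonempty_of_mem (inter_mem hA (h₀.alternating _ _ he' hz))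
      have h1 := ih n hn ⟨_, hn'⟩
      exact (h₀.disjoint _ _ h1 hn').elim

end Forced

/-- Adding a set `S` of points of one colour `e` to a partial colouring. -/
def addColour (K : Bool → Set (Ultrafilter ℕ)) (e : Bool) (S : Set (Ultrafilter ℕ)) :
    Bool → Set (Ultrafilter ℕ) := fun e' => K e' ∪ {z | z ∈ S ∧ e' = e}

theorem le_addColour {e : Bool} {S : Set (Ultrafilter ℕ)} : K ≤ addColour K e S :=
  fun _ _ hz => Or.inl hz

/-- A newly forced point outside `S` has almost all its children in `closure S`, and so lies in
`closure S` itself; this drives the induction and localises all new conflicts. -/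
theorem Forced.of_addColour (hx : ∀ z ∈ D, Separated (x z) ∧ p.bind (x z) = z) {e₀ : Bool}
    {S : Set (Ultrafilter ℕ)} {e : Bool} {z : Ultrafilter ℕ}
    (hz : Forced p x D (addColour K e₀ S) e z) :
    Forced p x D K e z ∨ (z ∈ S ∧ e = e₀) ∨ (z ∈ D ∧ (∀ᶠ n in p, x z n ∈ closure S) ∧
      ∀ᶠ n in p, Forced p x D (addColour K e₀ S) (!e) (x z n)) := by
  induction hz with
  | base hz => exact hz.imp Forced.base Or.inl
  | @step e z A hz hA hc ih =>
    have h : ∀ᶠ n in p, Forced p x D K (!e) (x z n) ∨ x z n ∈ closure S := by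
      filter_upwards [hA] with n hn
      rcases ih n hn with h | ⟨h, -⟩ | ⟨hD, h, -⟩
      · exact Or.inl h
      · exact Or.inr (subset_closure h)
      · refine Or.inr ?_
        rw [← (hx _ hD).2]
        exact Ultrafilter.bind_mem_closure h
    rcases Ultrafilter.eventually_or.1 h with h | h
    · exact Or.inl (Forced.of_eventually hz h)
    · exact Or.inr (Or.inr ⟨hz, h, mem_of_superset hA hc⟩)

/-- Consistency is kept when new points of one colour are added, provided that no point has almost
all of its children in their closure, except possibly points that already require this colour. -/
theorem Stage.stage_addColour (hx : ∀ z ∈ D, Separated (x z) ∧ p.bind (x z) = z)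
    (h₀ : ProperOn p x D K₀) (hK : Stage p x D K₀ K) {e₀ : Bool}
    {S : Set (Ultrafilter ℕ)} (hST : Thin p S) (hS : ∀ e, ∀ z ∈ S, ¬ Forced p x D K e z)
    (hSS : ∀ z ∈ S, z ∈ D → ¬ ∀ᶠ n in p, x z n ∈ closure S)
    (hSK : ∀ e z, z ∈ K e → (∀ e', z ∉ K₀ e') → z ∈ D → (∀ᶠ n in p, x z n ∈ closure S) →
      (∀ᶠ n in p, x z n ∈ S) ∧ Forced p x D K (!e₀) z) :
    Stage p x D K₀ (addColour K e₀ S) := by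
  have hne : ∀ z ∈ S, ¬ Forced p x D (addColour K e₀ S) (!e₀) z := by
    intro z hz h
    rcases h.of_addColour hx with h | ⟨-, h⟩ | ⟨hD, h, -⟩
    · exact hS _ z hz h
    · exact Bool.not_ne_self e₀ h
    · exact hSS z hz hD h
  have hbase : ∀ e z, z ∈ K e → (∃ e', z ∈ K₀ e') → z ∈ K₀ e := by
    rintro e z hz ⟨e', he'⟩
    rcases bool_cases e e' with rfl | rfl
    · exact he'
    · exact (hK.consistent _ _ (.base hz) (.base (hK.le _ he'))).elim
  refine ⟨hK.le.trans le_addColour, fun e z => Forced.consistent_of_base ?_, ?_⟩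
  · rintro e z (hz | ⟨hz, rfl⟩) hf
    · by_cases hz₀ : ∃ e', z ∈ K₀ e'
      · refine hK.consistent _ _ (.base hz) (.base (hK.le _ (hf.mem_of_properOn h₀ ?_ hz₀)))
        rintro e z (hz | ⟨hz, rfl⟩) hz₀
        · exact hbase e z hz hz₀
        · obtain ⟨e', he'⟩ := hz₀
          exact (hS e' z hz (.base (hK.le _ he'))).elim
      · push Not at hz₀
        rcases hf.of_addColour hx with h | ⟨h, -⟩ | ⟨hD, h, h'⟩
        · exact hK.consistent _ _ (.base hz) h
        · exact hS _ z h (.base hz)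
        · obtain ⟨h1, h2⟩ := hSK e z hz hz₀ hD h
          rcases bool_cases e e₀ with rfl | rfl
          · exact hK.consistent _ _ (.base hz) h2
          · obtain ⟨n, hn, hn'⟩ := (h1.and h').exists
            exact hne _ hn hn'
    · exact hne z hz hf
  · refine (hK.thin.union hST).mono ?_
    rintro z ⟨e, hz | ⟨hz, -⟩, hz₀⟩
    · exact Or.inl ⟨e, hz, hz₀⟩
    · exact Or.inr hz

theorem Stage.exists_forced (hp : ∀ a, ∀ᶠ n in (p : Filter ℕ), n ≠ a)
    (hx : ∀ z ∈ D, Separated (x z) ∧ p.bind (x z) = z)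
    (h₀ : ProperOn p x D K₀) (hK : Stage p x D K₀ K) (q : Ultrafilter ℕ) :
    ∃ K', K ≤ K' ∧ Stage p x D K₀ K' ∧ ∃ e, Forced p x D K' e q := by
  by_cases hq : ∃ e, Forced p x D K e q
  · exact ⟨K, le_rfl, hK, hq⟩
  push Not at hq
  have hq' : ∀ z ∈ D, ¬ ∀ᶠ n in p, x z n ∈ closure {q} := by
    intro z hz h
    rw [closure_singleton] at h
    obtain ⟨a, ha⟩ := h.exists
    obtain ⟨b, hb, hab⟩ := (h.and (hp a)).exists
    exact hab ((hx z hz).1.injective (hb.trans ha.symm))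
  refine ⟨addColour K true {q}, le_addColour, hK.stage_addColour hx h₀ (.singleton q) ?_
    (fun z _ hz => hq' z hz) (fun e z _ _ hz h => (hq' z hz h).elim), true,
    .base (Or.inr ⟨rfl, rfl⟩)⟩
  rintro e z rfl
  exact hq e

theorem Stage.exists_alternating (hp : ∀ a, ∀ᶠ n in (p : Filter ℕ), n ≠ a)
    (hx : ∀ z ∈ D, Separated (x z) ∧ p.bind (x z) = z)
    (h₀ : ProperOn p x D K₀) (hK : Stage p x D K₀ K) {q : Ultrafilter ℕ} (hqD : q ∈ D) {e : Bool}
    (hq : Forced p x D K e q) :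
    ∃ K', K ≤ K' ∧ Stage p x D K₀ K' ∧ ∀ᶠ n in p, Forced p x D K' (!e) (x q n) := by
  by_cases hf : ∃ e', ∀ᶠ n in p, Forced p x D K e' (x q n)
  · obtain ⟨e', he'⟩ := hf
    refine ⟨K, le_rfl, hK, ?_⟩
    rcases bool_cases e e' with rfl | rfl
    · exact (hK.consistent _ _ hq (.of_eventually hqD (by simpa using he'))).elim
    · exact he'
  push Not at hf
  -- Since `p` is an ultrafilter, almost all children are now forced to neither colour and are free
  -- to be coloured.
  have hf : ∀ e', ∀ᶠ n in p, ¬ Forced p x D K e' (x q n) := fun e' =>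
    Ultrafilter.eventually_not.2 (by simpa using hf e')
  have hthin := hK.thin (x q) (hx q hqD).1
  rw [(hx q hqD).2, Ultrafilter.mem_closure_iff_eventually] at hthin
  push Not at hthin
  obtain ⟨P, hP, hbad⟩ := hthin
  -- The set `P` comes from thinness. A new point `b ≠ q` with almost all its children in `closure
  -- S` would lie in `closure S`, hence contain `P`, which `hbad` excludes.
  let S : Set (Ultrafilter ℕ) :=
    {z | z ∈ Set.range (x q) ∧ (∀ᶠ k in z, P k) ∧ ∀ e', ¬ Forced p x D K e' z}
  have hSr : S ⊆ Set.range (x q) := fun z hz => hz.1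
  have hSev : ∀ᶠ n in p, x q n ∈ S := by
    rw [← (hx q hqD).2, Ultrafilter.eventually_bind] at hP
    filter_upwards [hP, hf true, hf false] with n h1 h2 h3
    refine ⟨⟨n, rfl⟩, h1, fun e' => ?_⟩
    cases e' <;> assumption
  refine ⟨addColour K (!e) S, le_addColour, hK.stage_addColour hx h₀
    ((Thin.range (hx q hqD).1).mono hSr) (fun e z hz => hz.2.2 e) ?_ ?_,
    hSev.mono fun n hn => .base (Or.inr ⟨hn, rfl⟩)⟩
  · intro z hzS hzD hz
    refine Separated.notMem_of_eventually_mem_closure hp (hx q hqD).1 (hx z hzD).1 hSr hz ?_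
    rwa [(hx z hzD).2]
  · intro e' b hb hb₀ hbD hbS
    by_cases hbq : b = q
    · subst hbq
      exact ⟨hSev, by rwa [Bool.not_not]⟩
    · have h1 := hbad b ⟨⟨e', hb, hb₀⟩, hbq, x b, (hx b hbD).1, (hx b hbD).2,
        hbS.mono fun n hn => closure_mono hSr hn⟩
      have h2 : b ∈ closure S := by
        rw [← (hx b hbD).2]
        exact Ultrafilter.bind_mem_closure hbS
      obtain ⟨w, hw, hw'⟩ := Ultrafilter.mem_closure_iff_eventually.1 h2 (fun k => ¬ P k)
        (by simpa using h1)
      obtain ⟨k, hk, hk'⟩ := (hw.2.1.and hw').exists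
      exact (hk' hk).elim

theorem Stage.step (hp : ∀ a, ∀ᶠ n in (p : Filter ℕ), n ≠ a)
    (hx : ∀ z ∈ D, Separated (x z) ∧ p.bind (x z) = z)
    (h₀ : ProperOn p x D K₀) (hK : Stage p x D K₀ K) (q : Ultrafilter ℕ) :
    ∃ K', K ≤ K' ∧ Stage p x D K₀ K' ∧ ∃ e, Forced p x D K' e q ∧
      (q ∈ D → ∀ᶠ n in p, Forced p x D K' (!e) (x q n)) := by
  obtain ⟨K₁, hle₁, hK₁, e, he⟩ := hK.exists_forced hp hx h₀ q
  by_cases hqD : q ∈ D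
  · obtain ⟨K₂, hle₂, hK₂, h⟩ := hK₁.exists_alternating hp hx h₀ hqD he
    exact ⟨K₂, hle₁.trans hle₂, hK₂, e, he.mono hle₂, fun _ => h⟩
  · exact ⟨K₁, hle₁, hK₁, e, he, fun h => (hqD h).elim⟩

theorem ProperOn.stage (h₀ : ProperOn p x D K₀) : Stage p x D K₀ K₀ := by
  refine ⟨le_rfl, fun e z => Forced.consistent_of_base fun e z hz hf => ?_, ?_⟩
  · exact h₀.disjoint _ _ hz (hf.mem_of_properOn h₀ (fun _ _ h _ => h) ⟨e, hz⟩)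
  · refine Thin.empty.mono ?_
    rintro z ⟨e, hz, h⟩
    exact (h e hz).elim

/-- A proper partial colouring extends to any given point. -/
theorem ProperOn.exists_extension (hp : ∀ a, ∀ᶠ n in (p : Filter ℕ), n ≠ a)
    (hx : ∀ z ∈ D, Separated (x z) ∧ p.bind (x z) = z)
    (h₀ : ProperOn p x D K₀) (q : Ultrafilter ℕ) :
    ∃ K, K₀ ≤ K ∧ ProperOn p x D K ∧ ∃ e, q ∈ K e := by
  obtain ⟨s, hs⟩ := exists_surjective_nat (List ℕ)
  -- Finite lists of indices are paths from `q` through successive children, so `pt` enumerates all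
  -- descendants of `q`.
  let pt : ℕ → Ultrafilter ℕ := fun k => (s k).foldl x q
  choose! next hle hstage hnext using
    fun (K : Bool → Set (Ultrafilter ℕ)) (hK : Stage p x D K₀ K) => hK.step hp hx h₀
  let seq : ℕ → Bool → Set (Ultrafilter ℕ) := fun k => Nat.rec K₀ (fun k K => next K (pt k)) k
  have hseq : ∀ k, Stage p x D K₀ (seq k) := by
    intro k
    induction k with
    | zero => exact h₀.stage
    | succ k ih => exact hstage _ ih _
  have hmono : Monotone seq := monotone_nat_of_le_succ fun k => hle _ (hseq k) _
  have huniq : ∀ k l e z, Forced p x D (seq k) e z → ¬ Forced p x D (seq l) (!e) z :=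
    fun k l e z h h' => (hseq (max k l)).consistent e z (h.mono (hmono (le_max_left k l)))
      (h'.mono (hmono (le_max_right k l)))
  -- The stages may force colours at other points too; restricting to `C` keeps the domain closed
  -- under children.
  let C : Set (Ultrafilter ℕ) := Set.range pt ∪ {z | ∃ e, z ∈ K₀ e}
  let K : Bool → Set (Ultrafilter ℕ) := fun e => {z | z ∈ C ∧ ∃ k, Forced p x D (seq k) e z}
  have hK₀ : K₀ ≤ K := fun e z hz => ⟨Or.inr ⟨e, hz⟩, 0, .base hz⟩
  have hptK : ∀ z ∈ Set.range pt, ∃ e, z ∈ K e := by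
    rintro _ ⟨k, rfl⟩
    obtain ⟨e, he, -⟩ := hnext (seq k) (hseq k) (pt k)
    exact ⟨e, Or.inl ⟨k, rfl⟩, k + 1, he⟩
  have hchild : ∀ z ∈ Set.range pt, ∀ n, x z n ∈ Set.range pt := by
    rintro _ ⟨k, rfl⟩ n
    obtain ⟨l, hl⟩ := hs (s k ++ [n])
    exact ⟨l, by simp [pt, hl]⟩
  have heq : ∀ e e' z, z ∈ K e → z ∈ K e' → e' = e := by
    rintro e e' z ⟨-, k, hk⟩ ⟨-, l, hl⟩
    rcases bool_cases e e' with h | rfl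
    · exact h
    · exact (huniq k l e z hk hl).elim
  refine ⟨K, hK₀, ⟨?_, ?_, ?_⟩, ?_⟩
  · rintro e z ⟨-, k, hk⟩ ⟨-, l, hl⟩
    exact huniq k l e z hk hl
  · rintro e z ⟨hz | ⟨e', hz⟩, -⟩ hD n
    · exact hptK _ (hchild z hz n)
    · obtain ⟨d, hd⟩ := h₀.closed _ _ hz hD n
      exact ⟨d, hK₀ _ hd⟩
  · intro e z hze hD
    rcases hze.1 with ⟨k, rfl⟩ | ⟨e', hz⟩
    · obtain ⟨e', he', h⟩ := hnext (seq k) (hseq k) (pt k)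
      obtain rfl := heq _ _ _ hze ⟨Or.inl ⟨k, rfl⟩, k + 1, he'⟩
      exact (h hD).mono fun n hn => ⟨Or.inl (hchild _ ⟨k, rfl⟩ n), k + 1, hn⟩
    · obtain rfl := heq _ _ _ hze (hK₀ _ hz)
      exact (h₀.alternating _ _ hz hD).mono fun n hn => hK₀ _ hn
  · obtain ⟨k, hk⟩ := hs []
    exact hptK q ⟨k, by simp [pt, hk]⟩

/-- There is a two-colouring in which every point of `D` differs from almost all its children. -/
theorem exists_alternating_colouring (hp : ∀ a, ∀ᶠ n in (p : Filter ℕ), n ≠ a)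
    (hx : ∀ z ∈ D, Separated (x z) ∧ p.bind (x z) = z) :
    ∃ c : Ultrafilter ℕ → Bool, ∀ z ∈ D, ∀ᶠ n in p, c (x z n) = !c z := by
  obtain ⟨K, hK⟩ := zorn_le₀ {K | ProperOn p x D K} (by
    intro c hc hchain
    refine ⟨fun e => ⋃ K ∈ c, K e, ⟨?_, ?_, ?_⟩, fun K hK e z hz => Set.mem_biUnion hK hz⟩
    · intro e z h h'
      simp only [Set.mem_iUnion, exists_prop] at h h'
      obtain ⟨K, hK, h⟩ := h
      obtain ⟨K', hK', h'⟩ := h'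
      rcases hchain.total hK hK' with hle | hle
      · exact (hc hK').disjoint _ _ (hle _ h) h'
      · exact (hc hK).disjoint _ _ h (hle _ h')
    · intro e z h hD n
      simp only [Set.mem_iUnion, exists_prop] at h ⊢
      obtain ⟨K, hK, h⟩ := h
      obtain ⟨e', he'⟩ := (hc hK).closed _ _ h hD n
      exact ⟨e', K, hK, he'⟩
    · intro e z h hD
      simp only [Set.mem_iUnion, exists_prop] at h ⊢
      obtain ⟨K, hK, h⟩ := h
      exact ((hc hK).alternating _ _ h hD).mono fun n hn => ⟨K, hK, hn⟩)
  have htotal : ∀ z, ∃ e, z ∈ K e := by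
    intro z
    obtain ⟨K', hle, hK', e, he⟩ := ProperOn.exists_extension hp hx hK.prop z
    exact ⟨e, hK.le_of_ge hK' hle _ he⟩
  choose c hc using htotal
  refine ⟨c, fun z hz => (hK.prop.alternating _ _ (hc z) hz).mono fun n hn => ?_⟩
  rcases bool_cases (!c z) (c (x z n)) with h | h
  · exact h
  · have := hc (x z n)
    rw [h] at this
    exact (hK.prop.disjoint _ _ hn this).elim

end Colouring

/-! ### From embedded copies of `ω ∪ {p}` to separated sequences, and the conclusion. -/

theorem separated_of_forall_exists {y : ℕ → Ultrafilter ℕ}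
    (h : ∀ n, ∃ P : ℕ → Prop, (∀ᶠ k in y n, P k) ∧ ∀ m ≠ n, ∀ᶠ k in y m, ¬ P k) :
    Separated y := by
  choose P hP hP' using h
  -- Taking the least `n` with `P n k` makes the countably many sets disjoint; each `y n` loses only
  -- finitely many null pieces.
  obtain ⟨g, hg⟩ : ∃ g : ℕ → ℕ, ∀ k n, P n k → (∀ i ∈ Set.Iio n, ¬ P i k) → g k = n := by
    classical
    refine ⟨fun k => if H : ∃ n, P n k then Nat.find H else 0, fun k n hn hi => ?_⟩
    have H : ∃ n, P n k := ⟨n, hn⟩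
    dsimp only
    rw [dif_pos H, Nat.find_eq_iff]
    exact ⟨hn, fun i hin => hi i hin⟩
  refine ⟨g, fun n => ?_⟩
  filter_upwards [hP n, (eventually_all_finite (Set.finite_Iio n)).2
    fun i (hi : i < n) => hP' i n hi.ne'] with k h1 h2 using hg k n h1 h2

/-- A copy of `ω ∪ {p}` consists of a separated family and its limit along `p`. -/
theorem exists_separated_of_isEmbedding {p : Ultrafilter ℕ}
    {f : omegaWithPoint p → Ultrafilter ℕ} (hf : Topology.IsEmbedding f) :
    ∃ y : ℕ → Ultrafilter ℕ, Separated y ∧ (∀ n, y n ∈ Set.range f) ∧ p.bind y ∈ Set.range f := by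
  let ι : ℕ → omegaWithPoint p := fun n => ⟨pure n, Or.inl ⟨n, rfl⟩⟩
  let q : omegaWithPoint p := ⟨p, Or.inr rfl⟩
  refine ⟨fun n => f (ι n), separated_of_forall_exists fun n => ?_, fun n => ⟨_, rfl⟩, q, ?_⟩
  · have ho : IsOpen ({ι n} : Set (omegaWithPoint p)) := by
      refine ⟨{u | {n} ∈ u}, ultrafilter_isOpen_basic _, ?_⟩
      ext ⟨u, hu⟩
      simp only [Set.mem_preimage, Set.mem_ofPred_eq, Set.mem_singleton_iff, ι]
      constructor
      · intro h
        refine Subtype.ext (Ultrafilter.eq_of_forall_eventually fun P hP => ?_).symm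
        filter_upwards [h] with k hk
        rw [Set.mem_singleton_iff.1 hk]
        exact hP
      · intro h
        obtain rfl : u = pure n := congrArg Subtype.val h
        exact Set.mem_singleton n
    obtain ⟨V, hV, hVn⟩ := hf.isInducing.isOpen_iff.1 ho
    have hn : f (ι n) ∈ V := by
      change ι n ∈ f ⁻¹' V
      rw [hVn]; rfl
    obtain ⟨_, ⟨A, rfl⟩, hA, hAV⟩ := ultrafilterBasis_is_basis.mem_nhds_iff.1 (hV.mem_nhds hn)
    refine ⟨(· ∈ A), hA, fun m hm => Ultrafilter.eventually_not.2 fun h => hm ?_⟩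
    have : ι m ∈ f ⁻¹' V := hAV h
    rw [hVn] at this
    exact Ultrafilter.pure_injective (congrArg Subtype.val this)
  · refine Ultrafilter.eq_of_forall_eventually fun P hP => ?_
    have ho : IsOpen (f ⁻¹' {u | {k | P k} ∈ u}) :=
      (ultrafilter_isOpen_basic _).preimage hf.continuous
    obtain ⟨V, hV, hVP⟩ := ho
    have hq : p ∈ V := by
      have : q ∈ Subtype.val ⁻¹' V := by rw [hVP]; exact hP
      exact this
    obtain ⟨_, ⟨A, rfl⟩, hA, hAV⟩ := ultrafilterBasis_is_basis.mem_nhds_iff.1 (hV.mem_nhds hq)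
    change ∀ᶠ n in p, ∀ᶠ k in f (ι n), P k
    filter_upwards [hA] with n hn
    have : ι n ∈ Subtype.val ⁻¹' V := hAV (show A ∈ (pure n : Ultrafilter ℕ) from hn)
    rw [hVP] at this
    exact this

/-- For every nonprincipal `p` the points of `β(ω)` can be coloured with two colours so that no
copy of `ω ∪ {p}` is monochromatic. -/
theorem exists_colouring_isEmbedding {p : Ultrafilter ℕ} (hp : p ∈ omegaStar) :
    ∃ c : Ultrafilter ℕ → Bool, ∀ f : omegaWithPoint p → Ultrafilter ℕ, Topology.IsEmbedding f →
      ∀ e, ∃ z ∈ Set.range f, c z ≠ e := by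
  have hp' : ∀ a, ∀ᶠ n in (p : Filter ℕ), n ≠ a := by
    intro a
    refine Ultrafilter.eventually_not.2 fun h => hp ⟨a, ?_⟩
    refine Ultrafilter.eq_of_forall_eventually fun P hP => ?_
    filter_upwards [h] with k hk
    rw [hk]
    exact hP
  let D : Set (Ultrafilter ℕ) := {q | ∃ y, Separated y ∧ p.bind y = q}
  have hD : ∀ q, ∃ y, q ∈ D → Separated y ∧ p.bind y = q := by
    intro q
    by_cases hq : q ∈ D
    · exact hq.imp fun _ h _ => h
    · exact ⟨pure, fun h => (hq h).elim⟩
  choose x hx using hD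
  obtain ⟨c, hc⟩ := exists_alternating_colouring hp' hx
  refine ⟨c, fun f hf e => ?_⟩
  obtain ⟨y, hy, hyf, hqf⟩ := exists_separated_of_isEmbedding hf
  by_contra! h
  have hqD : p.bind y ∈ D := ⟨y, hy, rfl⟩
  obtain ⟨n, h1, h2⟩ := ((hc _ hqD).and
    ((hx _ hqD).1.eventually_eq hy (hx _ hqD).2)).exists
  rw [h2, h _ (hyf n), h _ hqf] at h1
  exact Bool.not_ne_self e h1.symm

theorem theorem5p13 (p : Ultrafilter ℕ) (hp : p ∈ omegaStar) :
    ¬ TopArrow omegaStar (omegaWithPoint p) 1 (Fin 2) := by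
  intro h
  obtain ⟨c, hc⟩ := exists_colouring_isEmbedding hp
  obtain ⟨i, Y, ⟨φ⟩, hY⟩ := h
    (fun i => {A | Cardinal.mk A = 1 ∧ ∃ z ∈ A, c z.1 = decide (i = 0)}) (by
      ext A
      simp only [Set.mem_iUnion, Set.mem_ofPred_eq]
      constructor
      · intro hA
        obtain ⟨z⟩ := Cardinal.mk_ne_zero_iff.1 (hA.trans_ne one_ne_zero)
        cases hz : c z.1.1 with
        | true => exact ⟨0, hA, z.1, z.2, hz⟩
        | false => exact ⟨1, hA, z.1, z.2, hz⟩
      · rintro ⟨i, hA, -⟩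
        exact hA)
  obtain ⟨_, ⟨a, rfl⟩, ha⟩ := hc (fun a => (φ a).1.1)
    (Topology.IsEmbedding.subtypeVal.comp
      (Topology.IsEmbedding.subtypeVal.comp φ.isEmbedding)) (decide (i = 0))
  obtain ⟨-, z, hz, hcz⟩ := hY {(φ a).1} (Set.singleton_subset_iff.2 (φ a).2)
    (Cardinal.mk_singleton _)
  rw [Set.mem_singleton_iff.1 hz] at hcz
  exact ha hcz
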